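/- Let $G=S(\mathbb N)$ be the group of all permutations of $\mathbb N$ with the topology of pointwise convergence, and let $G$ act on the one-point compactification $\mathbb N\cup\{\infty\}$ of the discrete space $\mathbb N$, fixing $\infty$. Let $C(G)$ be the Banach algebra of bounded continuous functions $f:G\to\mathbb R$ with the supremum norm; for $g\in G$ put $(fg)(x)=f(gx)$ and $(gf)(x)=f(xg)$. Let $UC(G)$ be the algebra of all $f\in C(G)$ for which both orbit maps $g\mapsto fg$ and $g\mapsto gf$ from $G$ to $C(G)$ are norm continuous, and let $WAP(G)$ be the set of weakly almost periodic functions, i.e. of all $f\in C(G)$ whose orbit $\{fg:g\in G\}$ is relatively weakly compact in $C(G)$. For a uniformly closed unital subalgebra $A\subseteq C(G)$ invariant under all $f\mapsto fg$, let $G^A$ be its Gelfand space (nonzero multiplicative continuous linear functionals on $A$, weak-star topology) with the $G$-action $(g\varphi)(f)=\varphi(fg)$ and the canonical map $\nu:G\to G^A$, $\nu(x)(f)=f(x)$. Write $G^{WAP}$ (the universal WAP compactification) and $G^{UC}$ (the Roelcke compactification) for $A=WAP(G)$ and $A=UC(G)$. Let $E=E(G,\mathbb N\cup\{\infty\})$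 be the enveloping semigroup, i.e. the closure of $\{x\mapsto gx : g\in G\}$ in the product space $(\mathbb N\cup\{\infty\})^{\mathbb N\cup\{\infty\}}$. Then: 1. $UC(G)=WAP(G)$. 2. $G^{WAP}$, and likewise $G^{UC}$, is isomorphic to $E$: there is a homeomorphism $\Phi$ from it onto $E$ with $\Phi(\nu(g))=(x\mapsto gx)$ and $\Phi(g\varphi)=g\circ\Phi(\varphi)$ for all $g\in G$ and all $\varphi$. Moreover it carries a semitopological semigroup structure (an associative, separately continuous operation) for which $\nu$ is a homomorphism, and for every such structure $\Phi$ is an isomorphism of semigroups onto $E$ with composition of maps. 3. $E$ is precisely the set of maps $p_\alpha$, where $A\subseteq\mathbb N$, $\alpha:A\to\mathbb N$ is injective, $p_\alpha(x)=\alpha(x)$ for $x\in A$ and $p_\alpha(x)=\infty$ otherwise. 4. $E$ is homeomorphic to the Cantor set. -/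

import Mathlib

open Topology BoundedContinuousFunction

noncomputable section

namespace RoelckeSym

/-! ### Function algebras on a `G`-space -/

section GSpaces

variable (G : Type*) [Group G] (X : Type*) [TopologicalSpace X] [MulAction G X]
  [ContinuousConstSMul G X]

variable {G X} in
/-- The translate `f g` of a bounded continuous function: `(f g)(x) = f (g x)`. -/
def translate (g : G) (f : X →ᵇ ℝ) : X →ᵇ ℝ :=
  f.compContinuous ⟨fun x => g • x, continuous_const_smul g⟩

/-- `RUC(X)`: bounded continuous functions whose orbit map `g ↦ f g` is norm continuous. -/
def RUC [TopologicalSpace G] : Set (X →ᵇ ℝ) :=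
  {f | Continuous fun g : G => translate g f}

/-- `WAP(X)`: bounded continuous functions `f` whose orbit `{f g : g ∈ G}` is weakly precompact,
that is, has compact closure in the weak topology of the Banach space `C(X)` of bounded
continuous real functions. -/
def WAP : Set (X →ᵇ ℝ) :=
  {f | IsCompact (closure
    (toWeakSpace ℝ (X →ᵇ ℝ) '' Set.range fun g : G => translate g f))}

/-- The enveloping semigroup `E(G, X)`: the closure, in `X ^ X` with the product topology, of the
set of maps `x ↦ g x`, `g ∈ G`. -/
def envelopingSemigroup (G : Type*) [Group G] (X : Type*) [TopologicalSpace X] [MulAction G X] :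
    Set (X → X) :=
  closure (Set.range fun (g : G) (x : X) => g • x)

end GSpaces

/-! ### Function algebras on a topological group -/

section Groups

variable (G : Type*) [Group G] [TopologicalSpace G] [IsTopologicalGroup G]

variable {G} in
/-- The right translate `(g f)(x) = f (x g)`. -/
def rightTranslate (g : G) (f : G →ᵇ ℝ) : G →ᵇ ℝ :=
  f.compContinuous ⟨fun x => x * g, continuous_mul_const g⟩

/-- `LUC(G)`: bounded continuous functions for which `g ↦ g f` is norm continuous. -/
def LUC : Set (G →ᵇ ℝ) :=
  {f | Continuous fun g : G => rightTranslate g f}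

/-- A `G`-subalgebra of `C(G)`: a unital, uniformly closed subalgebra which is invariant under
the translations `f ↦ f g`. -/
structure GSubalgebra extends Subalgebra ℝ (G →ᵇ ℝ) where
  isClosed_carrier : IsClosed carrier
  translate_mem : ∀ (g : G) {f : G →ᵇ ℝ}, f ∈ carrier → translate g f ∈ carrier

variable {G}

lemma norm_translate_le (g : G) (f : G →ᵇ ℝ) : ‖translate g f‖ ≤ ‖f‖ :=
  (BoundedContinuousFunction.norm_le (norm_nonneg f)).2 fun x => f.norm_coe_le_norm (g • x)

lemma norm_rightTranslate_le (g : G) (f : G →ᵇ ℝ) : ‖rightTranslate g f‖ ≤ ‖f‖ :=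
  (BoundedContinuousFunction.norm_le (norm_nonneg f)).2 fun x => f.norm_coe_le_norm (x * g)

lemma continuous_translate (g : G) : Continuous (translate g : (G →ᵇ ℝ) → (G →ᵇ ℝ)) :=
  (LipschitzWith.of_dist_le_mul (K := 1) fun f h => by
    rw [dist_eq_norm, dist_eq_norm, NNReal.coe_one, one_mul]
    exact norm_translate_le g (f - h)).continuous

lemma continuous_rightTranslate (g : G) :
    Continuous (rightTranslate g : (G →ᵇ ℝ) → (G →ᵇ ℝ)) :=
  (LipschitzWith.of_dist_le_mul (K := 1) fun f h => by
    rw [dist_eq_norm, dist_eq_norm, NNReal.coe_one, one_mul]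
    exact norm_rightTranslate_le g (f - h)).continuous

/-- A family of contractions of a normed space: the vectors with continuous orbit map form a
closed set. -/
lemma isClosed_continuous_orbit {G : Type*} [TopologicalSpace G] (T : G → (G →ᵇ ℝ) → (G →ᵇ ℝ))
    (hT : ∀ g f h, dist (T g f) (T g h) ≤ dist f h) :
    IsClosed {f | Continuous fun g => T g f} := by
  rw [← isSeqClosed_iff_isClosed]
  intro u f hu huf
  refine TendstoUniformly.continuous (F := fun n g => T g (u n)) (p := Filter.atTop) ?_
    (Filter.Frequently.of_forall hu)
  rw [Metric.tendstoUniformly_iff]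
  intro ε hε
  filter_upwards [Metric.tendsto_nhds.1 huf ε hε] with n hn g
  exact lt_of_le_of_lt (hT g _ _) (by rwa [dist_comm])

variable (G) in
/-- `UC(G) = RUC(G) ∩ LUC(G)`. -/
def UC : GSubalgebra G where
  carrier := RUC G G ∩ LUC G
  mul_mem' {f h} hf hh := ⟨hf.1.mul hh.1, hf.2.mul hh.2⟩
  add_mem' {f h} hf hh := ⟨hf.1.add hh.1, hf.2.add hh.2⟩
  algebraMap_mem' c := ⟨continuous_const (y := algebraMap ℝ (G →ᵇ ℝ) c),
    continuous_const (y := algebraMap ℝ (G →ᵇ ℝ) c)⟩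
  isClosed_carrier := by
    refine IsClosed.inter (isClosed_continuous_orbit (fun g f => translate g f) ?_)
      (isClosed_continuous_orbit (fun g f => rightTranslate g f) ?_)
    · intro g f h
      rw [dist_eq_norm, dist_eq_norm]
      exact norm_translate_le g (f - h)
    · intro g f h
      rw [dist_eq_norm, dist_eq_norm]
      exact norm_rightTranslate_le g (f - h)
  translate_mem g f hf := by
    refine ⟨?_, ?_⟩
    · have h1 : (fun k : G => translate k (translate g f)) = fun k => translate (g * k) f := by
        ext k x
        exact congrArg f (mul_assoc g k x).symm
      change Continuous fun k : G => translate k (translate g f)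
      rw [h1]
      exact Continuous.comp (g := fun k : G => translate k f) hf.1 (continuous_const_mul g)
    · have h2 : (fun k : G => rightTranslate k (translate g f)) =
          fun k => translate g (rightTranslate k f) := by
        ext k x
        exact congrArg f (mul_assoc g x k).symm
      change Continuous fun k : G => rightTranslate k (translate g f)
      rw [h2]
      exact (continuous_translate g).comp hf.2

/-- The smallest `G`-subalgebra containing a set `F` of functions. When `F` is itself the
underlying set of a `G`-subalgebra, this is that `G`-subalgebra. -/
def GSubalgebra.generate (F : Set (G →ᵇ ℝ)) : GSubalgebra G where
  carrier := {f | ∀ A : GSubalgebra G, F ⊆ A.carrier → f ∈ A.carrier}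
  mul_mem' hf hh A hA := A.mul_mem' (hf A hA) (hh A hA)
  add_mem' hf hh A hA := A.add_mem' (hf A hA) (hh A hA)
  algebraMap_mem' c A _ := A.algebraMap_mem' c
  isClosed_carrier := by
    simp only [Set.ofPred_forall]
    exact isClosed_iInter fun A => isClosed_iInter fun _ => A.isClosed_carrier
  translate_mem g _ hf A hA := A.translate_mem g (hf A hA)

lemma GSubalgebra.generate_carrier (A : GSubalgebra G) :
    (GSubalgebra.generate A.carrier).carrier = A.carrier :=
  Set.Subset.antisymm (fun _ hf => hf A subset_rfl) fun _ hf _ hB => hB hf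

/-- The `G`-algebra `WAP(G)`. (That the set `WAP(G)` is already a `G`-subalgebra is classical;
passing to the generated `G`-subalgebra only makes the definition independent of this fact.) -/
def WAPAlgebra (G : Type*) [Group G] [TopologicalSpace G] [IsTopologicalGroup G] :
    GSubalgebra G :=
  GSubalgebra.generate (WAP G G)

/-! ### The compactification `G → G^A` of a `G`-subalgebra `A` -/

/-- The Gelfand space `G^A` of a `G`-subalgebra `A`: the nonzero multiplicative continuous
functionals on `A`, with the weak-star topology. -/
abbrev GSubalgebra.Gelfand (A : GSubalgebra G) : Type _ :=
  WeakDual.characterSpace ℝ A.toSubalgebra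

variable (A : GSubalgebra G)

/-- Translation by `g` as a continuous linear map of `A`. -/
def GSubalgebra.translateL (g : G) : A.toSubalgebra →L[ℝ] A.toSubalgebra where
  toFun f := ⟨translate g f.1, A.translate_mem g f.2⟩
  map_add' _ _ := rfl
  map_smul' _ _ := rfl
  cont := ((continuous_translate g).comp continuous_subtype_val).subtype_mk _

/-- The action of `G` on the Gelfand space: `(g φ)(f) = φ (f g)`. -/
instance : MulAction G A.Gelfand where
  smul g φ := ⟨(WeakDual.CharacterSpace.toCLM φ).comp (A.translateL g), by
    refine ⟨fun h0 => ?_, fun f h => map_mul φ (A.translateL g f) (A.translateL g h)⟩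
    have h1 : φ (A.translateL g 1) = 0 := congrArg (fun ψ : WeakDual ℝ A.toSubalgebra => ψ 1) h0
    have h2 : A.translateL g 1 = 1 := rfl
    rw [h2, map_one] at h1
    exact one_ne_zero h1⟩
  one_smul φ := by
    ext f
    refine congrArg φ (Subtype.ext ?_)
    ext x
    exact congrArg f.1 (one_mul x)
  mul_smul g h φ := by
    ext f
    refine congrArg φ (Subtype.ext ?_)
    ext x
    exact congrArg f.1 (mul_assoc g h x)

/-- The compactification map `ν : G → G^A`, `x ↦ eva_x`, where `eva_x(f) = f x`. -/
def GSubalgebra.eva (x : G) : A.Gelfand :=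
  ⟨({ toFun := fun f => f.1 x
      map_add' := fun _ _ => rfl
      map_smul' := fun _ _ => rfl
      cont := (BoundedContinuousFunction.evalCLM ℝ x).continuous.comp
        continuous_subtype_val } : A.toSubalgebra →L[ℝ] ℝ), by
    refine ⟨fun h0 => ?_, fun _ _ => rfl⟩
    have h1 : (1 : ℝ) = 0 := congrArg (fun ψ : WeakDual ℝ A.toSubalgebra => ψ 1) h0
    exact one_ne_zero h1⟩

/-- `mul` is an operation making `S` a semitopological semigroup (an associative operation that
is continuous in each variable separately) such that `ν : G → S` is a homomorphism. -/
structure IsSemitopologicalSemigroupLaw {S : Type*} [TopologicalSpace S] (ν : G → S)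
    (mul : S → S → S) : Prop where
  assoc : ∀ a b c, mul (mul a b) c = mul a (mul b c)
  continuous_left : ∀ s, Continuous fun t => mul t s
  continuous_right : ∀ s, Continuous fun t => mul s t
  map_mul : ∀ g h, ν (g * h) = mul (ν g) (ν h)

/-- The compactification `ν : G → G^A` is isomorphic to the enveloping semigroup `E(G, X)` (with
`G` mapped to `E(G, X)` by `g ↦ (x ↦ g x)`): there is a homeomorphism `Φ : G^A → E(G, X)` which
is compatible with the maps from `G`, is `G`-equivariant, and is an isomorphism of semigroups,
`E(G, X)` carrying composition of maps and `G^A` its semitopological semigroup structure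
extending the multiplication of `G`; such a structure exists. -/
def IsomorphicToEnvelopingSemigroup (A : GSubalgebra G) (X : Type*) [TopologicalSpace X]
    [MulAction G X] : Prop :=
  ∃ Φ : A.Gelfand ≃ₜ envelopingSemigroup G X,
    (∀ g : G, (Φ (A.eva g) : X → X) = fun x => g • x) ∧
    (∀ (g : G) (p : A.Gelfand), (Φ (g • p) : X → X) = fun x => g • (Φ p : X → X) x) ∧
    (∃ mul, IsSemitopologicalSemigroupLaw A.eva mul) ∧
    (∀ mul, IsSemitopologicalSemigroupLaw A.eva mul →
      ∀ p q, (Φ (mul p q) : X → X) = (Φ p : X → X) ∘ (Φ q : X → X))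

end Groups

/-! ### The group `S(ℕ)` and its action on `ℕ ∪ {∞}` -/

/-- The topology of pointwise convergence on the group `S(ℕ)` of permutations of the discrete
space `ℕ`. -/
instance : TopologicalSpace (Equiv.Perm ℕ) :=
  TopologicalSpace.induced (fun (g : Equiv.Perm ℕ) (n : ℕ) => g n) inferInstance

lemma continuous_perm_apply (n : ℕ) : Continuous fun g : Equiv.Perm ℕ => g n :=
  (continuous_apply n).comp continuous_induced_dom

lemma continuous_to_perm {Y : Type*} [TopologicalSpace Y] {F : Y → Equiv.Perm ℕ}
    (h : ∀ n, Continuous fun y => F y n) : Continuous F :=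
  continuous_induced_rng.2 (continuous_pi h)

instance : IsTopologicalGroup (Equiv.Perm ℕ) where
  continuous_mul := by
    refine continuous_to_perm fun n => ?_
    refine IsLocallyConstant.continuous ((IsLocallyConstant.iff_eventually_eq _).2 ?_)
    rintro ⟨g, h⟩
    have h1 : ∀ᶠ y : Equiv.Perm ℕ × Equiv.Perm ℕ in 𝓝 (g, h), y.2 n = h n :=
      (((continuous_perm_apply n).comp continuous_snd).tendsto (g, h)).eventually
        (isOpen_discrete {h n} |>.mem_nhds rfl)
    have h2 : ∀ᶠ y : Equiv.Perm ℕ × Equiv.Perm ℕ in 𝓝 (g, h), y.1 (h n) = g (h n) :=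
      (((continuous_perm_apply (h n)).comp continuous_fst).tendsto (g, h)).eventually
        (isOpen_discrete {g (h n)} |>.mem_nhds rfl)
    filter_upwards [h1, h2] with y hy1 hy2
    simp only [Equiv.Perm.mul_apply, hy1, hy2]
  continuous_inv := by
    refine continuous_to_perm fun n => ?_
    refine IsLocallyConstant.continuous ((IsLocallyConstant.iff_eventually_eq _).2 ?_)
    intro g
    have h1 : ∀ᶠ y : Equiv.Perm ℕ in 𝓝 g, y (g⁻¹ n) = g (g⁻¹ n) :=
      ((continuous_perm_apply (g⁻¹ n)).tendsto g).eventually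
        (isOpen_discrete {g (g⁻¹ n)} |>.mem_nhds rfl)
    filter_upwards [h1] with y hy
    rw [Equiv.Perm.inv_eq_iff_eq, hy]
    exact (Equiv.apply_symm_apply g n).symm

/-- The natural action of `S(ℕ)` on the one point compactification `ℕ ∪ {∞}`, fixing `∞`. -/
instance : MulAction (Equiv.Perm ℕ) (OnePoint ℕ) where
  smul g x := OnePoint.map g x
  one_smul x := by cases x <;> rfl
  mul_smul g h x := by cases x <;> rfl

open Classical in
/-- The extension by `∞` of a partial map `α : A → ℕ`, `A ⊆ ℕ`: the map `p_α` of `ℕ ∪ {∞}` to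
itself with `p_α(x) = α(x)` for `x ∈ A` and `p_α(x) = ∞` otherwise. -/
def extendByInfty (A : Set ℕ) (α : A → ℕ) (x : OnePoint ℕ) : OnePoint ℕ :=
  x.elim OnePoint.infty fun n => if h : n ∈ A then ((α ⟨n, h⟩ : ℕ) : OnePoint ℕ) else OnePoint.infty

end RoelckeSym

end

noncomputable section

namespace RoelckeSym

open Filter

/-! ### The enveloping semigroup of `S(ℕ)` acting on `ℕ ∪ {∞}` -/

lemma perm_smul_coe (g : Equiv.Perm ℕ) (n : ℕ) : g • (n : OnePoint ℕ) = (g n : ℕ) := rfl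

lemma perm_smul_infty (g : Equiv.Perm ℕ) : g • (OnePoint.infty : OnePoint ℕ) = OnePoint.infty := rfl

lemma exists_perm_eqOn (S : Finset ℕ) (f : ℕ → ℕ) (hf : Set.InjOn f S) :
    ∃ g : Equiv.Perm ℕ, ∀ n ∈ S, g n = f n := by
  have h := Equiv.Perm.isMultiplyPretransitive ℕ S.card
  let e := S.equivFin
  obtain ⟨g, hg⟩ := h.exists_smul_eq
    (e.symm.toEmbedding.trans (Function.Embedding.subtype _))
    ⟨fun i => f (e.symm i), fun i j hij =>
      e.symm.injective (Subtype.ext (hf (e.symm i).2 (e.symm j).2 hij))⟩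
  refine ⟨g, fun n hn => ?_⟩
  have := DFunLike.congr_fun hg (e ⟨n, hn⟩)
  change g (e.symm (e ⟨n, hn⟩)) = f (e.symm (e ⟨n, hn⟩)) at this
  rwa [e.symm_apply_apply] at this

lemma isClopen_singleton_coe (n : ℕ) : IsClopen ({(n : OnePoint ℕ)} : Set (OnePoint ℕ)) := by
  refine ⟨isClosed_singleton, ?_⟩
  have := OnePoint.isOpen_image_coe (s := ({n} : Set ℕ)).2 (isOpen_discrete _)
  simpa using this

lemma continuous_onePoint_of_isClopen {Y : Type*} [TopologicalSpace Y] {F : Y → OnePoint ℕ}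
    (h : ∀ n : ℕ, IsClopen {y | F y = n}) : Continuous F := by
  refine continuous_def.2 fun s hs => ?_
  have key : ∀ t : Set ℕ, F ⁻¹' ((↑) '' t) = ⋃ n ∈ t, {y | F y = n} := by
    intro t
    ext y
    simp [eq_comm]
  by_cases h0 : OnePoint.infty ∈ s
  · have h1 := ((OnePoint.isOpen_iff_of_mem h0).1 hs).2
    have h2 : s = ((↑) '' ((((↑) : ℕ → OnePoint ℕ) ⁻¹' s)ᶜ))ᶜ := by
      ext x
      induction x using OnePoint.rec <;> simp [h0]
    rw [h2, Set.preimage_compl, isOpen_compl_iff, key]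
    exact h1.finite_of_discrete.isClosed_biUnion fun n _ => (h n).1
  · have h2 : s = (↑) '' (((↑) : ℕ → OnePoint ℕ) ⁻¹' s) := by
      ext x
      induction x using OnePoint.rec <;> simp [h0]
    rw [h2, key]
    exact isOpen_biUnion fun n _ => (h n).2

/-- A self-map of `ℕ ∪ {∞}` which fixes `∞` and is injective off the preimage of `∞`. -/
def IsPartialInjection (p : OnePoint ℕ → OnePoint ℕ) : Prop :=
  p OnePoint.infty = OnePoint.infty ∧ ∀ a b c : ℕ, p a = c → p b = c → a = b

lemma isPartialInjection_smul (g : Equiv.Perm ℕ) :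
    IsPartialInjection fun x : OnePoint ℕ => g • x := by
  refine ⟨rfl, fun a b c ha hb => ?_⟩
  simp only [perm_smul_coe, OnePoint.coe_eq_coe] at ha hb
  exact g.injective (ha.trans hb.symm)

lemma IsPartialInjection.comp {p q : OnePoint ℕ → OnePoint ℕ} (hp : IsPartialInjection p)
    (hq : IsPartialInjection q) : IsPartialInjection (p ∘ q) := by
  refine ⟨by simp [hq.1, hp.1], fun a b c ha hb => ?_⟩
  have key : ∀ a : ℕ, (p ∘ q) a = c → ∃ k : ℕ, q a = k := by
    intro a ha
    by_contra hne
    have : q a = OnePoint.infty := by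
      by_contra h
      obtain ⟨k, hk⟩ := OnePoint.ne_infty_iff_exists.1 h
      exact hne ⟨k, hk.symm⟩
    simp [this, hp.1] at ha
  obtain ⟨k, hk⟩ := key a ha
  obtain ⟨l, hl⟩ := key b hb
  simp only [Function.comp_apply, hk, hl] at ha hb
  obtain rfl := hp.2 _ _ _ ha hb
  exact hq.2 _ _ _ hk hl

lemma IsPartialInjection.continuous {p : OnePoint ℕ → OnePoint ℕ} (hp : IsPartialInjection p) :
    Continuous p := by
  refine continuous_onePoint_of_isClopen fun n => ?_
  by_cases h : ∃ a : ℕ, p a = n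
  · obtain ⟨a, ha⟩ := h
    convert isClopen_singleton_coe a
    ext x
    induction x using OnePoint.rec with
    | infty => simp [hp.1]
    | coe b => simpa using ⟨fun hb => hp.2 _ _ _ hb ha, fun h => h ▸ ha⟩
  · convert isClopen_empty
    ext x
    induction x using OnePoint.rec with
    | infty => simp [hp.1]
    | coe b => simpa using fun hb => h ⟨b, hb⟩

lemma isClosed_isPartialInjection : IsClosed {p | IsPartialInjection p} := by
  have h1 : IsClosed {p : OnePoint ℕ → OnePoint ℕ | p OnePoint.infty = OnePoint.infty} :=
    isClosed_eq (continuous_apply _) continuous_const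
  have h2 : ∀ a b c : ℕ,
      IsClosed {p : OnePoint ℕ → OnePoint ℕ | p a = c → p b = c → a = b} := by
    intro a b c
    have ho : ∀ a : ℕ, IsOpen {p : OnePoint ℕ → OnePoint ℕ | p a = (c : OnePoint ℕ)} := fun a =>
      (isClopen_singleton_coe c).2.preimage
        (f := fun p : OnePoint ℕ → OnePoint ℕ => p a) (continuous_apply _)
    exact isClosed_imp (ho a) (isClosed_imp (ho b) isClosed_const)
  have : {p | IsPartialInjection p} = {p | p OnePoint.infty = OnePoint.infty} ∩
      ⋂ (a : ℕ) (b : ℕ) (c : ℕ),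
        {p | p a = (c : OnePoint ℕ) → p b = (c : OnePoint ℕ) → a = b} := by
    ext p
    simp [IsPartialInjection]
  rw [this]
  exact h1.inter (isClosed_iInter fun a => isClosed_iInter fun b => isClosed_iInter fun c => h2 a b c)

open Classical in
lemma IsPartialInjection.exists_perm {p : OnePoint ℕ → OnePoint ℕ} (hp : IsPartialInjection p)
    (N : ℕ) : ∃ g : Equiv.Perm ℕ, ∀ i < N,
      (∀ j : ℕ, p i = j → g i = j) ∧ (p i = OnePoint.infty → N ≤ g i) := by
  let k : ℕ → ℕ := fun i => (p i).elim 0 id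
  let M := N + ∑ i ∈ Finset.range N, k i + 1
  have hk : ∀ i < N, k i < M := fun i hi => by
    have := Finset.single_le_sum (f := k) (fun _ _ => Nat.zero_le _) (Finset.mem_range.2 hi)
    omega
  have hcases : ∀ i : ℕ, p i = OnePoint.infty ∨ p i = k i := by
    intro i
    simp only [k]
    induction p i using OnePoint.rec <;> simp
  obtain ⟨g, hg⟩ := exists_perm_eqOn (Finset.range N)
    (fun i => if p i = OnePoint.infty then M + i else k i) (by
      intro i hi j hj hij
      have hi' := hk i (by simpa using hi)
      have hj' := hk j (by simpa using hj)
      simp only at hij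
      rcases hcases i with h1 | h1 <;> rcases hcases j with h2 | h2
      · simpa [h1, h2] using hij
      · simp only [h1, h2, if_true, OnePoint.coe_ne_infty, if_false] at hij
        omega
      · simp only [h1, h2, if_true, OnePoint.coe_ne_infty, if_false] at hij
        omega
      · simp only [h1, h2, OnePoint.coe_ne_infty, if_false] at hij
        exact hp.2 _ _ _ h1 (hij ▸ h2))
  refine ⟨g, fun i hi => ⟨fun j hj => ?_, fun h => ?_⟩⟩
  · rw [hg i (Finset.mem_range.2 hi)]
    simp [hj, k]
  · rw [hg i (Finset.mem_range.2 hi), if_pos h]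
    omega

lemma mem_envelopingSemigroup_iff {p : OnePoint ℕ → OnePoint ℕ} :
    p ∈ envelopingSemigroup (Equiv.Perm ℕ) (OnePoint ℕ) ↔ IsPartialInjection p := by
  refine ⟨fun h => ?_, fun hp => ?_⟩
  · refine closure_minimal ?_ isClosed_isPartialInjection h
    rintro _ ⟨g, rfl⟩
    exact isPartialInjection_smul g
  · choose g hg using hp.exists_perm
    refine mem_closure_of_tendsto (f := fun N (x : OnePoint ℕ) => g N • x) (b := atTop)
      (tendsto_pi_nhds.2 fun x => ?_) (Eventually.of_forall fun N => ⟨g N, rfl⟩)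
    induction x using OnePoint.rec with
    | infty => simp only [perm_smul_infty, hp.1]; exact tendsto_const_nhds
    | coe i =>
      by_cases h : p i = OnePoint.infty
      · rw [h]
        have h1 : Tendsto (fun N => g N i) atTop (coclosedCompact ℕ) := by
          rw [coclosedCompact_eq_cocompact, cocompact_eq_cofinite, Nat.cofinite_eq_atTop]
          refine tendsto_atTop_mono' atTop ?_ tendsto_id
          filter_upwards [eventually_gt_atTop i] with N hN
          exact (hg N i hN).2 h
        exact OnePoint.tendsto_coe_infty.comp h1
      · obtain ⟨j, hj⟩ := OnePoint.ne_infty_iff_exists.1 h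
        refine tendsto_const_nhds.congr' ?_
        filter_upwards [eventually_gt_atTop i] with N hN
        rw [perm_smul_coe, (hg N i hN).1 j hj.symm, hj]

lemma envelopingSemigroup_eq_extendByInfty :
    envelopingSemigroup (Equiv.Perm ℕ) (OnePoint ℕ) =
      {p | ∃ (A : Set ℕ) (α : A → ℕ), Function.Injective α ∧ p = extendByInfty A α} := by
  ext p
  rw [mem_envelopingSemigroup_iff]
  constructor
  · intro hp
    refine ⟨{n | p n ≠ OnePoint.infty}, fun n => (p ((n : ℕ) : OnePoint ℕ)).elim 0 id, ?_, ?_⟩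
    · rintro ⟨a, ha⟩ ⟨b, hb⟩ hab
      obtain ⟨k, hk⟩ := OnePoint.ne_infty_iff_exists.1 ha
      obtain ⟨l, hl⟩ := OnePoint.ne_infty_iff_exists.1 hb
      simp only [← hk, ← hl, OnePoint.elim_some, id] at hab
      exact Subtype.ext (hp.2 a b k hk.symm (hab ▸ hl.symm))
    · funext x
      induction x using OnePoint.rec with
      | infty => simpa [extendByInfty] using hp.1
      | coe n =>
        by_cases h : p n = OnePoint.infty
        · simp [extendByInfty, h]
        · obtain ⟨k, hk⟩ := OnePoint.ne_infty_iff_exists.1 h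
          simp [extendByInfty, ← hk]
  · rintro ⟨A, α, hα, rfl⟩
    refine ⟨rfl, fun a b c ha hb => ?_⟩
    have key : ∀ a : ℕ, extendByInfty A α a = c → ∃ h : a ∈ A, α ⟨a, h⟩ = c := by
      intro a ha
      by_cases h : a ∈ A
      · exact ⟨h, by simpa [extendByInfty, h] using ha⟩
      · simp [extendByInfty, h] at ha
    obtain ⟨h1, h2⟩ := key a ha
    obtain ⟨h3, h4⟩ := key b hb
    exact congrArg Subtype.val (hα (h2.trans h4.symm))

/-- The enveloping semigroup of `S(ℕ)` acting on `ℕ ∪ {∞}`, as a type. -/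
abbrev PartialInj : Type := envelopingSemigroup (Equiv.Perm ℕ) (OnePoint ℕ)

namespace PartialInj

lemma isPartialInjection (p : PartialInj) : IsPartialInjection p.1 :=
  mem_envelopingSemigroup_iff.1 p.2

instance : CompactSpace PartialInj := isCompact_iff_compactSpace.1 isClosed_closure.isCompact

/-- Composition of partial injections. -/
def comp (p q : PartialInj) : PartialInj :=
  ⟨p.1 ∘ q.1, mem_envelopingSemigroup_iff.2 (p.isPartialInjection.comp q.isPartialInjection)⟩

/-- A permutation as a partial injection. -/
def ofPerm (g : Equiv.Perm ℕ) : PartialInj := ⟨fun x => g • x, subset_closure ⟨g, rfl⟩⟩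

lemma ofPerm_apply_eq {g : Equiv.Perm ℕ} {i j : ℕ} : (ofPerm g).1 i = j ↔ g i = j :=
  OnePoint.coe_eq_coe

lemma ofPerm_mul (g h : Equiv.Perm ℕ) : ofPerm (g * h) = comp (ofPerm g) (ofPerm h) :=
  Subtype.ext (funext fun x => mul_smul g h x)

lemma denseRange_ofPerm : DenseRange ofPerm := by
  intro p
  rw [closure_subtype]
  have : (Subtype.val '' Set.range ofPerm) =
      Set.range fun (g : Equiv.Perm ℕ) (x : OnePoint ℕ) => g • x := by
    rw [← Set.range_comp]
    rfl
  rw [this]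
  exact p.2

lemma isClopen_apply_eq (i j : ℕ) : IsClopen {p : PartialInj | p.1 i = j} :=
  (isClopen_singleton_coe j).preimage
    ((continuous_apply (i : OnePoint ℕ)).comp continuous_subtype_val)

lemma continuous_of_isClopen {Y : Type*} [TopologicalSpace Y] {F : Y → PartialInj}
    (h : ∀ i j : ℕ, IsClopen {y | (F y).1 i = j}) : Continuous F := by
  refine Continuous.subtype_mk (f := fun y => (F y).1) (continuous_pi fun x => ?_) _
  induction x using OnePoint.rec with
  | infty => simpa only [fun y => (F y).isPartialInjection.1] using continuous_const
  | coe i => exact continuous_onePoint_of_isClopen (h i)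

lemma ext_iff_apply {p q : PartialInj} : p = q ↔ ∀ i j : ℕ, p.1 i = j ↔ q.1 i = j := by
  refine ⟨fun h => by simp [h], fun h => Subtype.ext (funext fun x => ?_)⟩
  induction x using OnePoint.rec with
  | infty => rw [p.isPartialInjection.1, q.isPartialInjection.1]
  | coe i =>
    by_cases hp : p.1 i = OnePoint.infty
    · by_contra hq
      rw [hp] at hq
      obtain ⟨j, hj⟩ := OnePoint.ne_infty_iff_exists.1 (Ne.symm hq)
      rw [(h i j).2 hj.symm] at hp
      simp at hp
    · obtain ⟨j, hj⟩ := OnePoint.ne_infty_iff_exists.1 hp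
      rw [← hj, (h i j).1 hj.symm]

lemma comp_apply_eq {p q : PartialInj} {i j : ℕ} :
    (comp p q).1 i = j ↔ ∃ k : ℕ, q.1 i = k ∧ p.1 k = j := by
  refine ⟨fun h => ?_, ?_⟩
  · change p.1 (q.1 i) = j at h
    by_cases hq : q.1 i = OnePoint.infty
    · simp [hq, p.isPartialInjection.1] at h
    · obtain ⟨k, hk⟩ := OnePoint.ne_infty_iff_exists.1 hq
      exact ⟨k, hk.symm, by rwa [hk]⟩
  · rintro ⟨k, hk, h⟩
    change p.1 (q.1 i) = j
    rwa [hk]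

lemma continuous_ofPerm : Continuous ofPerm := by
  refine continuous_of_isClopen fun i j => ?_
  simp only [ofPerm_apply_eq]
  exact (isClopen_discrete {j}).preimage (continuous_perm_apply i)

lemma isInducing_ofPerm : IsInducing ofPerm := by
  refine ⟨le_antisymm (continuous_iff_le_induced.1 continuous_ofPerm) ?_⟩
  rw [← continuous_id_iff_le]
  refine @continuous_to_perm _ (_) _ fun n => ?_
  refine (@continuous_discrete_rng _ _ (_) _ _ _).2 fun m => ?_
  refine ⟨{p : PartialInj | p.1 n = m}, (isClopen_apply_eq n m).2, ?_⟩
  ext g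
  exact ofPerm_apply_eq

lemma continuous_comp_left (q : PartialInj) : Continuous fun p => comp p q :=
  Continuous.subtype_mk (f := fun p : PartialInj => p.1 ∘ q.1)
    (continuous_pi fun x => (continuous_apply (q.1 x)).comp continuous_subtype_val) _

lemma continuous_comp_right (p : PartialInj) : Continuous fun q => comp p q :=
  Continuous.subtype_mk (f := fun q : PartialInj => p.1 ∘ q.1)
    (continuous_pi fun x => p.isPartialInjection.continuous.comp
      ((continuous_apply x).comp continuous_subtype_val)) _

lemma continuous_ofPerm_comp :
    Continuous fun y : Equiv.Perm ℕ × PartialInj => comp (ofPerm y.1) y.2 := by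
  refine continuous_of_isClopen fun i j => ?_
  have : {y : Equiv.Perm ℕ × PartialInj | (comp (ofPerm y.1) y.2).1 i = j} =
      {y | y.2.1 i = ((y.1⁻¹ j : ℕ) : OnePoint ℕ)} := by
    ext y
    simp only [Set.mem_ofPred_eq, comp_apply_eq, ofPerm_apply_eq]
    constructor
    · rintro ⟨k, hk, rfl⟩
      simpa using hk
    · intro h
      exact ⟨_, h, by simp⟩
  rw [this]
  have h1 : Continuous fun y : Equiv.Perm ℕ × PartialInj => y.1⁻¹ j :=
    (continuous_perm_apply j).comp (continuous_inv.comp continuous_fst)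
  have h2 : ∀ k : ℕ, IsClopen {y : Equiv.Perm ℕ × PartialInj | y.1⁻¹ j = k} := fun k =>
    (isClopen_discrete {k}).preimage h1
  have h3 : ∀ k : ℕ, IsClopen {y : Equiv.Perm ℕ × PartialInj | y.2.1 i = k} := fun k =>
    (isClopen_apply_eq i k).preimage continuous_snd
  constructor
  · have : {y : Equiv.Perm ℕ × PartialInj | y.2.1 i = ((y.1⁻¹ j : ℕ) : OnePoint ℕ)} =
        ⋂ k : ℕ, {y | y.1⁻¹ j = k → y.2.1 i = (k : OnePoint ℕ)} := by
      ext y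
      simp
    rw [this]
    exact isClosed_iInter fun k => isClosed_imp (h2 k).2 (h3 k).1
  · have : {y : Equiv.Perm ℕ × PartialInj | y.2.1 i = ((y.1⁻¹ j : ℕ) : OnePoint ℕ)} =
        ⋃ k : ℕ, {y | y.1⁻¹ j = k ∧ y.2.1 i = (k : OnePoint ℕ)} := by
      ext y
      simp
    rw [this]
    exact isOpen_iUnion fun k => (h2 k).2.inter (h3 k).2

lemma continuous_comp_ofPerm :
    Continuous fun y : Equiv.Perm ℕ × PartialInj => comp y.2 (ofPerm y.1) := by
  refine continuous_of_isClopen fun i j => ?_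
  have h1 : Continuous fun y : Equiv.Perm ℕ × PartialInj => y.1 i :=
    (continuous_perm_apply i).comp continuous_fst
  have h2 : ∀ k : ℕ, IsClopen {y : Equiv.Perm ℕ × PartialInj | y.1 i = k} := fun k =>
    (isClopen_discrete {k}).preimage h1
  have h3 : ∀ k : ℕ, IsClopen {y : Equiv.Perm ℕ × PartialInj | y.2.1 k = j} := fun k =>
    (isClopen_apply_eq k j).preimage continuous_snd
  simp only [comp_apply_eq, ofPerm_apply_eq]
  constructor
  · have : {y : Equiv.Perm ℕ × PartialInj | ∃ k : ℕ, y.1 i = k ∧ y.2.1 k = j} =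
        ⋂ k : ℕ, {y | y.1 i = k → y.2.1 k = (j : OnePoint ℕ)} := by
      ext y
      simp
    rw [this]
    exact isClosed_iInter fun k => isClosed_imp (h2 k).2 (h3 k).1
  · have : {y : Equiv.Perm ℕ × PartialInj | ∃ k : ℕ, y.1 i = k ∧ y.2.1 k = j} =
        ⋃ k : ℕ, {y | y.1 i = k ∧ y.2.1 k = (j : OnePoint ℕ)} := by
      ext y
      simp
    rw [this]
    exact isOpen_iUnion fun k => (h2 k).2.inter (h3 k).2

/-- Two partial injections agree below `N` if their graphs agree on `{0, …, N - 1}²`. -/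
def AgreeBelow (N : ℕ) (p q : PartialInj) : Prop :=
  ∀ i < N, ∀ j < N, p.1 i = (j : OnePoint ℕ) ↔ q.1 i = (j : OnePoint ℕ)

lemma AgreeBelow.symm {N : ℕ} {p q : PartialInj} (h : AgreeBelow N p q) : AgreeBelow N q p :=
  fun i hi j hj => (h i hi j hj).symm

lemma AgreeBelow.trans {N : ℕ} {p q r : PartialInj} (h : AgreeBelow N p q)
    (h' : AgreeBelow N q r) : AgreeBelow N p r :=
  fun i hi j hj => (h i hi j hj).trans (h' i hi j hj)

lemma eventually_agreeBelow (N : ℕ) (p : PartialInj) : ∀ᶠ q in 𝓝 p, AgreeBelow N p q := by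
  have h : ∀ᶠ q in 𝓝 p, ∀ i ∈ Finset.range N, ∀ j ∈ Finset.range N,
      (p.1 i = (j : OnePoint ℕ) ↔ q.1 i = (j : OnePoint ℕ)) := by
    simp only [Finset.eventually_all]
    intro i _ j _
    by_cases hp : p.1 i = (j : OnePoint ℕ)
    · filter_upwards [(isClopen_apply_eq i j).2.mem_nhds hp] with q hq
      exact iff_of_true hp hq
    · filter_upwards [(isClopen_apply_eq i j).compl.2.mem_nhds hp] with q hq
      exact iff_of_false hp hq
  filter_upwards [h] with q hq i hi j hj
  exact hq i (Finset.mem_range.2 hi) j (Finset.mem_range.2 hj)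

lemma exists_agreeBelow_ofPerm (p : PartialInj) (N : ℕ) :
    ∃ g : Equiv.Perm ℕ, AgreeBelow N p (ofPerm g) := by
  obtain ⟨_, ⟨g, rfl⟩, hg⟩ := mem_closure_iff_frequently.1 (denseRange_ofPerm p) |>.and_eventually
    (eventually_agreeBelow N p) |>.exists
  exact ⟨g, hg⟩

end PartialInj

/-! ### Closed perfect subsets of `ℕ → Bool` -/

section Branching

variable (K : Set (ℕ → Bool))

/-- The level `n` is branching for `x` if some element of `K` first differs from `x` there. -/
def Branches (x : ℕ → Bool) (n : ℕ) : Prop :=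
  ∃ y ∈ K, (∀ i < n, y i = x i) ∧ y n ≠ x n

variable {K}

lemma Branches.congr {x y : ℕ → Bool} (hx : x ∈ K) {n : ℕ} (h : ∀ i < n, x i = y i)
    (hB : Branches K x n) : Branches K y n := by
  obtain ⟨z, hz, hzx, hzn⟩ := hB
  by_cases hxy : x n = y n
  · exact ⟨z, hz, fun i hi => (hzx i hi).trans (h i hi), hxy ▸ hzn⟩
  · exact ⟨x, hx, h, hxy⟩

open Classical in
lemma count_branches_congr {x y : ℕ → Bool} (hx : x ∈ K) (hy : y ∈ K) {n : ℕ}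
    (h : ∀ i < n, x i = y i) : Nat.count (Branches K x) n = Nat.count (Branches K y) n := by
  rw [Nat.count_eq_card_filter_range, Nat.count_eq_card_filter_range]
  congr 1
  refine Finset.filter_congr fun k hk => ?_
  have hk' := Finset.mem_range.1 hk
  exact ⟨Branches.congr hx fun i hi => h i (hi.trans hk'),
    Branches.congr hy fun i hi => (h i (hi.trans hk')).symm⟩

open Classical in
lemma nth_branches_congr {x y : ℕ → Bool} (hx : x ∈ K) (hy : y ∈ K)
    (hinf : {n | Branches K x n}.Infinite) {k : ℕ}
    (h : ∀ i < Nat.nth (Branches K x) k, x i = y i) :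
    Nat.nth (Branches K y) k = Nat.nth (Branches K x) k := by
  have h1 : Branches K y (Nat.nth (Branches K x) k) :=
    Branches.congr hx h (Nat.nth_mem_of_infinite hinf k)
  have h2 : Nat.count (Branches K y) (Nat.nth (Branches K x) k) = k := by
    rw [← count_branches_congr hx hy h, Nat.count_nth_of_infinite hinf]
  rw [← h2, Nat.nth_count h1, h2]

/-- A nonempty compact subset of `ℕ → Bool` each of whose elements has infinitely many branching
levels is homeomorphic to `ℕ → Bool`. -/
theorem nonempty_homeomorph_of_branches (hK : IsCompact K) (hne : K.Nonempty)
    (hinf : ∀ x ∈ K, {n | Branches K x n}.Infinite) : Nonempty (K ≃ₜ (ℕ → Bool)) := by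
  classical
  have := isCompact_iff_compactSpace.1 hK
  let Φ : K → (ℕ → Bool) := fun x k => x.1 (Nat.nth (Branches K x.1) k)
  have hcont : Continuous Φ := by
    refine continuous_pi fun k => ?_
    refine IsLocallyConstant.continuous ((IsLocallyConstant.iff_eventually_eq _).2 fun x => ?_)
    have h1 : ∀ᶠ y : K in 𝓝 x, ∀ i ∈ Finset.range (Nat.nth (Branches K x.1) k + 1),
        x.1 i = y.1 i := by
      rw [Finset.eventually_all]
      intro i _
      have : ContinuousAt (fun y : K => y.1 i) x :=
        ((continuous_apply i).comp continuous_subtype_val).continuousAt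
      filter_upwards [this.eventually ((isOpen_discrete {x.1 i}).mem_nhds rfl)] with y hy
      exact hy.symm
    filter_upwards [h1] with y hy
    change y.1 _ = x.1 _
    rw [nth_branches_congr x.2 y.2 (hinf x x.2) fun i hi => hy i (by simp; omega)]
    exact (hy _ (by simp)).symm
  have hinj : Function.Injective Φ := by
    intro x y hxy
    by_contra hne
    have hex : ∃ n, x.1 n ≠ y.1 n := by
      by_contra! h
      exact hne (Subtype.ext (funext h))
    have hlt : ∀ i < Nat.find hex, x.1 i = y.1 i := fun i hi => not_not.1 (Nat.find_min hex hi)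
    have hB : Branches K x.1 (Nat.find hex) :=
      ⟨y.1, y.2, fun i hi => (hlt i hi).symm, (Nat.find_spec hex).symm⟩
    have h1 : Nat.nth (Branches K x.1) (Nat.count (Branches K x.1) (Nat.find hex)) =
      Nat.find hex := Nat.nth_count hB
    have h2 := nth_branches_congr x.2 y.2 (hinf x x.2) (by rw [h1]; exact hlt)
    have h3 := congrFun hxy (Nat.count (Branches K x.1) (Nat.find hex))
    simp only [Φ] at h3
    rw [h2, h1] at h3
    exact Nat.find_spec hex h3
  have happrox : ∀ (y : ℕ → Bool) (k : ℕ), ∃ x : K, ∀ l < k, Φ x l = y l := by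
    intro y k
    induction k with
    | zero => exact ⟨⟨hne.some, hne.some_mem⟩, by simp⟩
    | succ k ih =>
      obtain ⟨x, hx⟩ := ih
      by_cases hk : Φ x k = y k
      · refine ⟨x, fun l hl => ?_⟩
        rcases Nat.lt_succ_iff_lt_or_eq.1 hl with h | rfl
        exacts [hx l h, hk]
      · obtain ⟨z, hz, hzx, hzn⟩ := Nat.nth_mem_of_infinite (hinf x x.2) k
        have hnth : ∀ l ≤ k, Nat.nth (Branches K z) l = Nat.nth (Branches K x.1) l := fun l hl =>
          nth_branches_congr x.2 hz (hinf x x.2) fun i hi => (hzx i (hi.trans_le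
            ((Nat.nth_strictMono (hinf x x.2)).monotone hl))).symm
        refine ⟨⟨z, hz⟩, fun l hl => ?_⟩
        rcases Nat.lt_succ_iff_lt_or_eq.1 hl with h | rfl
        · rw [← hx l h]
          simp only [Φ, hnth l h.le]
          exact hzx _ (Nat.nth_strictMono (hinf x x.2) h)
        · simp only [Φ, hnth l le_rfl]
          simp only [Φ] at hk
          revert hzn hk
          cases z (Nat.nth (Branches K x.1) l) <;> cases x.1 (Nat.nth (Branches K x.1) l) <;>
            cases y l <;> simp
  have hsurj : Function.Surjective Φ := by
    intro y
    have hcl : IsClosed (Set.range Φ) := (isCompact_range hcont).isClosed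
    choose x hx using happrox y
    rw [← Set.mem_range]
    refine hcl.mem_of_tendsto (b := atTop) (f := fun k : ℕ => Φ (x k)) (tendsto_pi_nhds.2 fun l => ?_)
      (Eventually.of_forall fun k => Set.mem_range_self (x k))
    refine tendsto_const_nhds.congr' ?_
    filter_upwards [eventually_gt_atTop l] with k hk
    exact (hx k l hk).symm
  exact ⟨hcont.homeoOfEquivCompactToT2 (f := Equiv.ofBijective Φ ⟨hinj, hsurj⟩)⟩

end Branching

namespace PartialInj

open Classical in
/-- The graph of a partial injection, as a point of the Cantor space. -/
def graph (p : PartialInj) (n : ℕ) : Bool :=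
  decide (p.1 ((Nat.unpair n).1 : ℕ) = ((Nat.unpair n).2 : ℕ))

lemma graph_eq_true {p : PartialInj} {n : ℕ} :
    graph p n = true ↔ p.1 ((Nat.unpair n).1 : ℕ) = ((Nat.unpair n).2 : ℕ) := by
  simp [graph]

lemma continuous_graph : Continuous graph := by
  refine continuous_pi fun n => ?_
  refine (continuous_bool_rng true).2 ?_
  convert isClopen_apply_eq (Nat.unpair n).1 (Nat.unpair n).2
  ext p
  exact graph_eq_true

lemma injective_graph : Function.Injective graph := by
  intro p q h
  refine ext_iff_apply.2 fun i j => ?_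
  have h1 := graph_eq_true (p := p) (n := Nat.pair i j)
  have h2 := graph_eq_true (p := q) (n := Nat.pair i j)
  rw [h] at h1
  simp only [Nat.unpair_pair] at h1 h2
  exact h1.symm.trans h2

lemma isClosedEmbedding_graph : IsClosedEmbedding graph :=
  continuous_graph.isClosedEmbedding injective_graph

/-- Above every level, the graph of a partial injection has a branching level. -/
lemma exists_branches_graph (p : PartialInj) (N : ℕ) :
    ∃ n ≥ N, Branches (Set.range graph) (graph p) n := by
  classical
  have hlow : ∀ q, AgreeBelow N p q → ∀ i < N, graph p i = graph q i := by
    intro q hq i hi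
    rw [Bool.eq_iff_iff, graph_eq_true, graph_eq_true]
    exact hq _ ((Nat.unpair_left_le i).trans_lt hi) _ ((Nat.unpair_right_le i).trans_lt hi)
  obtain ⟨q, hpq, hne⟩ : ∃ q, AgreeBelow N p q ∧ p ≠ q := by
    obtain ⟨g, hg⟩ := exists_agreeBelow_ofPerm p N
    by_cases hp : p = ofPerm g
    · refine ⟨ofPerm (Equiv.swap N (N + 1) * g), fun i hi j hj => ?_, fun h => ?_⟩
      · rw [hp, ofPerm_apply_eq, ofPerm_apply_eq, Equiv.Perm.mul_apply, Equiv.swap_apply_eq_iff,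
          Equiv.swap_apply_of_ne_of_ne (by omega) (by omega)]
      · rw [hp, ext_iff_apply] at h
        have := (h (g⁻¹ N) N).1 (ofPerm_apply_eq.2 (by simp))
        rw [ofPerm_apply_eq] at this
        simp at this
    · exact ⟨_, hg, hp⟩
  have hex : ∃ n, graph p n ≠ graph q n := by
    by_contra! h
    exact hne (injective_graph (funext h))
  refine ⟨Nat.find hex, ?_, graph q, ⟨q, rfl⟩, fun i hi => (not_not.1 (Nat.find_min hex hi)).symm,
    (Nat.find_spec hex).symm⟩
  by_contra! hlt
  exact Nat.find_spec hex (hlow q hpq _ hlt)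

theorem nonempty_homeomorph_cantorSet : Nonempty (PartialInj ≃ₜ cantorSet) := by
  obtain ⟨e⟩ := nonempty_homeomorph_of_branches (K := Set.range graph)
    (isCompact_range continuous_graph) ⟨_, ofPerm 1, rfl⟩ (by
      rintro _ ⟨p, rfl⟩
      refine Set.infinite_of_not_bddAbove fun ⟨M, hM⟩ => ?_
      obtain ⟨n, hn, hB⟩ := exists_branches_graph p (M + 1)
      have := hM hB
      omega)
  exact ⟨(isClosedEmbedding_graph.isEmbedding.toHomeomorph.trans e).trans
    cantorSetHomeomorphNatToBool.symm⟩

end PartialInj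

/-! ### The Roelcke compactification of `S(ℕ)` -/

lemma exists_fixing_subset {s : Set (Equiv.Perm ℕ)} (hs : s ∈ 𝓝 (1 : Equiv.Perm ℕ)) :
    ∃ N : ℕ, ∀ g : Equiv.Perm ℕ, (∀ i < N, g i = i) → g ∈ s := by
  by_contra! h
  choose g hg hgs using h
  have h1 : Tendsto g atTop (𝓝 1) := by
    rw [(IsInducing.mk rfl : IsInducing fun (g : Equiv.Perm ℕ) (n : ℕ) => g n).tendsto_nhds_iff,
      tendsto_pi_nhds]
    intro i
    refine tendsto_const_nhds.congr' ?_
    filter_upwards [eventually_gt_atTop i] with N hN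
    exact (hg N i hN).symm
  obtain ⟨N, hN⟩ := (h1.eventually hs).exists
  exact hgs N hN

/-- Permutations which agree below `N` lie in the same double coset of the pointwise stabilizer
of `{0, …, N - 1}`. -/
lemma exists_mul_mul_eq_of_agreeBelow {N : ℕ} {x y : Equiv.Perm ℕ}
    (h : PartialInj.AgreeBelow N (PartialInj.ofPerm x) (PartialInj.ofPerm y)) :
    ∃ u v : Equiv.Perm ℕ, (∀ i < N, u i = i) ∧ (∀ i < N, v i = i) ∧ y = u * x * v := by
  have hxy : ∀ i < N, ∀ j < N, x i = j ↔ y i = j := fun i hi j hj => by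
    have := h i hi j hj
    rwa [PartialInj.ofPerm_apply_eq, PartialInj.ofPerm_apply_eq] at this
  obtain ⟨u, hu⟩ := exists_perm_eqOn (Finset.range N ∪ (Finset.range N).image x)
    (fun k => if k < N then k else y (x⁻¹ k)) (by
      have key : ∀ k l : ℕ, k < N → ¬ l < N → l ∈ Finset.range N ∪ (Finset.range N).image x →
          k ≠ y (x⁻¹ l) := by
        intro k l hk hl hmem heq
        simp only [Finset.mem_union, Finset.mem_range, hl, false_or, Finset.mem_image] at hmem
        obtain ⟨i, hi, rfl⟩ := hmem
        rw [Equiv.Perm.inv_def, Equiv.symm_apply_apply] at heq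
        exact hl ((hxy i hi k hk).2 heq.symm ▸ hk)
      intro k hk l hl hkl
      simp only at hkl
      split_ifs at hkl with h1 h2 h2
      · exact hkl
      · exact absurd hkl (key k l h1 h2 hl)
      · exact absurd hkl.symm (key l k h2 h1 hk)
      · exact x⁻¹.injective (y.injective hkl))
  have hu1 : ∀ i < N, u i = i := fun i hi => by
    rw [hu i (by simp [hi]), if_pos hi]
  have hu2 : ∀ i < N, u (x i) = y i := fun i hi => by
    by_cases hx : x i < N
    · rw [hu1 _ hx]
      exact ((hxy i hi _ hx).1 rfl).symm
    · rw [hu (x i) (by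
        refine Finset.mem_union_right _ (Finset.mem_image_of_mem _ (Finset.mem_range.2 hi))),
        if_neg hx, Equiv.Perm.inv_def, Equiv.symm_apply_apply]
  refine ⟨u, x⁻¹ * u⁻¹ * y, hu1, fun i hi => ?_, by group⟩
  rw [Equiv.Perm.mul_apply, ← hu2 i hi]
  simp

lemma exists_agreeBelow_abs_sub_le {f : Equiv.Perm ℕ →ᵇ ℝ} (hf : f ∈ (UC (Equiv.Perm ℕ)).carrier)
    {ε : ℝ} (hε : 0 < ε) : ∃ N : ℕ, ∀ x y : Equiv.Perm ℕ,
      PartialInj.AgreeBelow N (PartialInj.ofPerm x) (PartialInj.ofPerm y) → |f x - f y| < ε := by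
  have h1 := (hf.1.tendsto (1 : Equiv.Perm ℕ)).eventually (Metric.ball_mem_nhds _ (half_pos hε))
  have h2 := (hf.2.tendsto (1 : Equiv.Perm ℕ)).eventually (Metric.ball_mem_nhds _ (half_pos hε))
  obtain ⟨N, hN⟩ := exists_fixing_subset (h1.and h2)
  refine ⟨N, fun x y hxy => ?_⟩
  obtain ⟨u, v, hu, hv, rfl⟩ := exists_mul_mul_eq_of_agreeBelow hxy
  have h3 : dist (f (u * (x * v))) (f (1 * (x * v))) < ε / 2 :=
    (dist_coe_le_dist (f := translate u f) (g := translate 1 f) (x * v)).trans_lt (hN u hu).1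
  have h4 : dist (f (x * v)) (f (x * 1)) < ε / 2 :=
    (dist_coe_le_dist (f := rightTranslate v f) (g := rightTranslate 1 f) x).trans_lt (hN v hv).2
  rw [one_mul, ← mul_assoc] at h3
  rw [mul_one] at h4
  rw [← Real.dist_eq, dist_comm]
  linarith [dist_triangle (f (u * x * v)) (f (x * v)) (f x)]

namespace PartialInj

lemma isDenseInducing_ofPerm : IsDenseInducing ofPerm := ⟨isInducing_ofPerm, denseRange_ofPerm⟩

/-- The continuous extension to `PartialInj` of a function in `UC(S(ℕ))`. -/
def extend (f : (UC (Equiv.Perm ℕ)).toSubalgebra) : C(PartialInj, ℝ) where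
  toFun := isDenseInducing_ofPerm.extend f.1
  continuous_toFun := by
    refine isDenseInducing_ofPerm.continuous_extend fun p => ?_
    have := isDenseInducing_ofPerm.comap_nhds_neBot p
    refine cauchy_map_iff_exists_tendsto.1 (Metric.cauchy_iff.2 ⟨inferInstance, fun ε hε => ?_⟩)
    obtain ⟨N, hN⟩ := exists_agreeBelow_abs_sub_le f.2 hε
    refine ⟨_, image_mem_map (preimage_mem_comap (eventually_agreeBelow N p)), ?_⟩
    rintro _ ⟨x, hx, rfl⟩ _ ⟨y, hy, rfl⟩
    exact hN x y (AgreeBelow.trans (AgreeBelow.symm hx) hy)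

lemma extend_ofPerm (f : (UC (Equiv.Perm ℕ)).toSubalgebra) (g : Equiv.Perm ℕ) :
    extend f (ofPerm g) = f.1 g :=
  isDenseInducing_ofPerm.extend_eq f.1.continuous g

lemma eq_of_ofPerm {F F' : C(PartialInj, ℝ)} (h : ∀ g, F (ofPerm g) = F' (ofPerm g)) : F = F' :=
  ContinuousMap.coe_injective
    (denseRange_ofPerm.equalizer F.continuous F'.continuous (funext h))

lemma dist_extend_apply_le (f h : (UC (Equiv.Perm ℕ)).toSubalgebra) (p : PartialInj) :
    dist (extend f p) (extend h p) ≤ dist f h := by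
  induction p using denseRange_ofPerm.induction_on with
  | hp => exact isClosed_le ((extend f).continuous.dist (extend h).continuous) continuous_const
  | ih g =>
    rw [extend_ofPerm, extend_ofPerm]
    exact dist_coe_le_dist (f := f.1) (g := h.1) g

/-- The restriction to `S(ℕ)` of a continuous function on `PartialInj`. -/
def restrict (F : C(PartialInj, ℝ)) : Equiv.Perm ℕ →ᵇ ℝ :=
  (mkOfCompact F).compContinuous ⟨ofPerm, continuous_ofPerm⟩

lemma continuous_restrict : Continuous restrict :=
  (continuous_compContinuous ⟨ofPerm, continuous_ofPerm⟩).comp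
    (ContinuousMap.linearIsometryBoundedOfCompact PartialInj ℝ ℝ).continuous

lemma restrict_mem_UC (F : C(PartialInj, ℝ)) : restrict F ∈ (UC (Equiv.Perm ℕ)).carrier := by
  constructor
  · have h := continuous_restrict.comp (ContinuousMap.curry
      ⟨fun y : Equiv.Perm ℕ × PartialInj => F (comp (ofPerm y.1) y.2),
        F.continuous.comp continuous_ofPerm_comp⟩).continuous
    refine h.congr fun g => (
      BoundedContinuousFunction.ext fun x => congrArg F (ofPerm_mul g x)).symm
  · have h := continuous_restrict.comp (ContinuousMap.curry
      ⟨fun y : Equiv.Perm ℕ × PartialInj => F (comp y.2 (ofPerm y.1)),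
        F.continuous.comp continuous_comp_ofPerm⟩).continuous
    refine h.congr fun g => (
      BoundedContinuousFunction.ext fun x => congrArg F (ofPerm_mul x g)).symm

/-- Restriction of functions from `PartialInj` to `S(ℕ)`, with values in `UC(S(ℕ))`. -/
def restrictL : C(PartialInj, ℝ) →L[ℝ] (UC (Equiv.Perm ℕ)).toSubalgebra where
  toFun F := ⟨restrict F, restrict_mem_UC F⟩
  map_add' _ _ := rfl
  map_smul' _ _ := rfl
  cont := continuous_restrict.subtype_mk _

lemma restrictL_extend (f : (UC (Equiv.Perm ℕ)).toSubalgebra) : restrictL (extend f) = f :=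
  Subtype.ext (BoundedContinuousFunction.ext fun g => extend_ofPerm f g)

lemma extend_restrictL (F : C(PartialInj, ℝ)) : extend (restrictL F) = F :=
  eq_of_ofPerm fun g => extend_ofPerm _ g

lemma extend_add (f h : (UC (Equiv.Perm ℕ)).toSubalgebra) :
    extend (f + h) = extend f + extend h :=
  eq_of_ofPerm fun g => by
    rw [ContinuousMap.add_apply, extend_ofPerm, extend_ofPerm, extend_ofPerm]
    rfl

lemma extend_smul (c : ℝ) (f : (UC (Equiv.Perm ℕ)).toSubalgebra) :
    extend (c • f) = c • extend f :=
  eq_of_ofPerm fun g => by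
    rw [ContinuousMap.smul_apply, extend_ofPerm, extend_ofPerm]
    rfl

lemma extend_mul (f h : (UC (Equiv.Perm ℕ)).toSubalgebra) :
    extend (f * h) = extend f * extend h :=
  eq_of_ofPerm fun g => by
    rw [ContinuousMap.mul_apply, extend_ofPerm, extend_ofPerm, extend_ofPerm]
    rfl

lemma extend_one : extend 1 = 1 :=
  eq_of_ofPerm fun g => by
    rw [extend_ofPerm]
    rfl

/-- Evaluation at a partial injection of the extension of functions in `UC(S(ℕ))`, as a continuous
linear functional. -/
def evalExtend (p : PartialInj) : (UC (Equiv.Perm ℕ)).toSubalgebra →L[ℝ] ℝ :=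
  { toFun := fun f => extend f p
    map_add' := fun f h => DFunLike.congr_fun (extend_add f h) p
    map_smul' := fun c f => DFunLike.congr_fun (extend_smul c f) p
    cont := (LipschitzWith.of_dist_le_mul (K := 1) fun f h =>
      (dist_extend_apply_le f h p).trans_eq (one_mul _).symm).continuous }

/-- Evaluation at a partial injection of the extension of functions in `UC(S(ℕ))`, as a
character. -/
def toGelfand (p : PartialInj) : (UC (Equiv.Perm ℕ)).Gelfand :=
  ⟨evalExtend p, by
    rw [WeakDual.CharacterSpace.eq_set_map_one_map_mul]
    exact ⟨DFunLike.congr_fun extend_one p, fun f h => DFunLike.congr_fun (extend_mul f h) p⟩⟩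

lemma toGelfand_apply (p : PartialInj) (f : (UC (Equiv.Perm ℕ)).toSubalgebra) :
    toGelfand p f = extend f p := rfl

lemma continuous_toGelfand : Continuous toGelfand :=
  Continuous.subtype_mk (WeakDual.continuous_of_continuous_eval
    fun f => (extend f).continuous) _

lemma toGelfand_bijective : Function.Bijective toGelfand := by
  constructor
  · intro p q h
    refine (WeakDual.CharacterSpace.continuousMapEval_bijective PartialInj ℝ).1 ?_
    ext F
    have := DFunLike.congr_fun h (restrictL F)
    rwa [toGelfand_apply, toGelfand_apply, extend_restrictL] at this
  · intro φ
    obtain ⟨p, hp⟩ := (WeakDual.CharacterSpace.continuousMapEval_bijective PartialInj ℝ).2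
      (⟨(WeakDual.CharacterSpace.toCLM φ).comp restrictL, by
        rw [WeakDual.CharacterSpace.eq_set_map_one_map_mul]
        exact ⟨map_one φ, fun F F' => map_mul φ (restrictL F) (restrictL F')⟩⟩ :
        WeakDual.characterSpace ℝ C(PartialInj, ℝ))
    refine ⟨p, ?_⟩
    ext f
    have h1 : extend f p = φ (restrictL (extend f)) := DFunLike.congr_fun hp (extend f)
    rw [toGelfand_apply, h1, restrictL_extend]

/-- The Roelcke compactification of `S(ℕ)` is homeomorphic to `PartialInj`. -/
def gelfandHomeomorph : (UC (Equiv.Perm ℕ)).Gelfand ≃ₜ PartialInj :=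
  (continuous_toGelfand.homeoOfEquivCompactToT2
    (f := Equiv.ofBijective toGelfand toGelfand_bijective)).symm

lemma gelfandHomeomorph_symm_apply (p : PartialInj) : gelfandHomeomorph.symm p = toGelfand p := rfl

lemma gelfandHomeomorph_eva (g : Equiv.Perm ℕ) :
    gelfandHomeomorph ((UC (Equiv.Perm ℕ)).eva g) = ofPerm g := by
  rw [← Homeomorph.eq_symm_apply, gelfandHomeomorph_symm_apply]
  ext f
  exact (extend_ofPerm f g).symm

lemma gelfandHomeomorph_smul (g : Equiv.Perm ℕ) (φ : (UC (Equiv.Perm ℕ)).Gelfand) :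
    gelfandHomeomorph (g • φ) = comp (ofPerm g) (gelfandHomeomorph φ) := by
  obtain ⟨p, rfl⟩ := gelfandHomeomorph.symm.surjective φ
  rw [← Homeomorph.eq_symm_apply, Homeomorph.apply_symm_apply, gelfandHomeomorph_symm_apply,
    gelfandHomeomorph_symm_apply]
  ext f
  change extend ((UC (Equiv.Perm ℕ)).translateL g f) p = extend f (comp (ofPerm g) p)
  refine DFunLike.congr_fun (eq_of_ofPerm (F' := (extend f).comp
    ⟨fun p => comp (ofPerm g) p, continuous_comp_right _⟩) fun x => ?_) p
  change _ = extend f (comp (ofPerm g) (ofPerm x))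
  rw [extend_ofPerm, ← ofPerm_mul, extend_ofPerm]
  rfl

theorem isomorphicToEnvelopingSemigroup_UC :
    IsomorphicToEnvelopingSemigroup (UC (Equiv.Perm ℕ)) (OnePoint ℕ) := by
  refine ⟨gelfandHomeomorph, fun g => congrArg Subtype.val (gelfandHomeomorph_eva g),
    fun g φ => congrArg Subtype.val (gelfandHomeomorph_smul g φ),
    ⟨fun φ ψ => gelfandHomeomorph.symm (comp (gelfandHomeomorph φ) (gelfandHomeomorph ψ)), ?_⟩,
    fun mul hmul φ ψ => ?_⟩
  · refine ⟨fun a b c => ?_, fun s => ?_, fun s => ?_, fun g h => ?_⟩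
    · simp only [Homeomorph.apply_symm_apply]
      rfl
    · exact gelfandHomeomorph.symm.continuous.comp
        ((continuous_comp_left _).comp gelfandHomeomorph.continuous)
    · exact gelfandHomeomorph.symm.continuous.comp
        ((continuous_comp_right _).comp gelfandHomeomorph.continuous)
    · rw [Homeomorph.eq_symm_apply, gelfandHomeomorph_eva, gelfandHomeomorph_eva,
        gelfandHomeomorph_eva, ofPerm_mul]
  · have hdense : DenseRange (UC (Equiv.Perm ℕ)).eva := by
      have h1 : (UC (Equiv.Perm ℕ)).eva = gelfandHomeomorph.symm ∘ ofPerm := funext fun g => by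
        rw [Function.comp_apply, Homeomorph.eq_symm_apply, gelfandHomeomorph_eva]
      rw [h1]
      exact gelfandHomeomorph.symm.surjective.denseRange.comp denseRange_ofPerm
        gelfandHomeomorph.symm.continuous
    suffices h : gelfandHomeomorph (mul φ ψ) =
      comp (gelfandHomeomorph φ) (gelfandHomeomorph ψ) from congrArg Subtype.val h
    have hleft : ∀ (g : Equiv.Perm ℕ) ψ, gelfandHomeomorph (mul ((UC (Equiv.Perm ℕ)).eva g) ψ) =
        comp (gelfandHomeomorph ((UC (Equiv.Perm ℕ)).eva g)) (gelfandHomeomorph ψ) := by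
      intro g
      refine congrFun (hdense.equalizer
        (gelfandHomeomorph.continuous.comp (hmul.continuous_right _))
        ((continuous_comp_right _).comp gelfandHomeomorph.continuous) (funext fun h => ?_))
      simp only [Function.comp_apply, ← hmul.map_mul, gelfandHomeomorph_eva, ofPerm_mul]
    exact congrFun (hdense.equalizer
      (gelfandHomeomorph.continuous.comp (hmul.continuous_left ψ))
      ((continuous_comp_left (gelfandHomeomorph ψ)).comp gelfandHomeomorph.continuous)
      (funext fun g => hleft g ψ)) φ

end PartialInj

/-! ### Weakly almost periodic functions are uniformly continuous -/

lemma continuous_weakSpace_apply {X : Type*} [TopologicalSpace X] (x : X) :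
    Continuous fun k : WeakSpace ℝ (X →ᵇ ℝ) => (toWeakSpace ℝ (X →ᵇ ℝ)).symm k x :=
  WeakBilin.eval_continuous (topDualPairing ℝ (X →ᵇ ℝ)).flip (evalCLM ℝ x)

/-- A map with separable range from a Baire space to a metric space, such that preimages of closed
balls are closed, has small oscillation on some nonempty open set. -/
lemma exists_isOpen_dist_le {X M : Type*} [TopologicalSpace X] [BaireSpace X] [Nonempty X]
    [PseudoMetricSpace M] {F : X → M} (hsep : TopologicalSpace.IsSeparable (Set.range F))
    (hcl : ∀ (m : M) (r : ℝ), 0 ≤ r → IsClosed {x | dist (F x) m ≤ r}) {ε : ℝ} (hε : 0 < ε) :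
    ∃ V : Set X, IsOpen V ∧ V.Nonempty ∧ ∀ x ∈ V, ∀ y ∈ V, dist (F x) (F y) ≤ ε := by
  obtain ⟨c, hc, hFc⟩ := hsep
  have := hc.to_subtype
  obtain ⟨m, hm⟩ := nonempty_interior_of_iUnion_of_closed
    (f := fun m : c => {x | dist (F x) m ≤ ε / 2}) (fun m => hcl m _ (half_pos hε).le) (by
      refine Set.eq_univ_of_forall fun x => ?_
      obtain ⟨m, hm, hxm⟩ := Metric.mem_closure_iff.1 (hFc ⟨x, rfl⟩) (ε / 2) (half_pos hε)
      exact Set.mem_iUnion.2 ⟨⟨m, hm⟩, hxm.le⟩)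
  refine ⟨_, isOpen_interior, hm, fun x hx y hy => ?_⟩
  have hsub := interior_subset (s := {x | dist (F x) m ≤ ε / 2})
  have h1 : dist (F x) m ≤ ε / 2 := hsub hx
  have h2 : dist (F y) m ≤ ε / 2 := hsub hy
  linarith [dist_triangle_right (F x) (F y) m]

section WAP

variable {G : Type*} [Group G] [TopologicalSpace G] [IsTopologicalGroup G] {f : G →ᵇ ℝ}

/-- The weak closure of the orbit of `f`. -/
def weakOrbitClosure (f : G →ᵇ ℝ) : Set (WeakSpace ℝ (G →ᵇ ℝ)) :=
  closure (toWeakSpace ℝ (G →ᵇ ℝ) '' Set.range fun g : G => translate g f)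

/-- The orbit map of `f`, with values in the weak closure of the orbit. -/
def weakOrbit (f : G →ᵇ ℝ) (g : G) : weakOrbitClosure f :=
  ⟨toWeakSpace ℝ (G →ᵇ ℝ) (translate g f), subset_closure ⟨_, ⟨g, rfl⟩, rfl⟩⟩

/-- The value at `x` of an element of the weak closure of the orbit. -/
def weakEval (f : G →ᵇ ℝ) (x : G) : C(weakOrbitClosure f, ℝ) :=
  ⟨fun k => (toWeakSpace ℝ (G →ᵇ ℝ)).symm k.1 x,
    (continuous_weakSpace_apply x).comp continuous_subtype_val⟩

lemma weakEval_weakOrbit (f : G →ᵇ ℝ) (x g : G) : weakEval f x (weakOrbit f g) = f (g * x) := rfl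

lemma continuous_weakEval (f : G →ᵇ ℝ) (k : weakOrbitClosure f) :
    Continuous fun x => weakEval f x k :=
  ((toWeakSpace ℝ (G →ᵇ ℝ)).symm k.1).continuous

lemma eq_of_weakEval {D : Set G} (hD : Dense D) {k l : weakOrbitClosure f}
    (h : ∀ x ∈ D, weakEval f x k = weakEval f x l) : k = l := by
  refine Subtype.ext ((toWeakSpace ℝ (G →ᵇ ℝ)).symm.injective (DFunLike.coe_injective ?_))
  exact (continuous_weakEval f k).ext_on hD (continuous_weakEval f l) h

lemma continuous_weakOrbit (hf : f ∈ WAP G G) : Continuous (weakOrbit f) := by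
  have : CompactSpace (weakOrbitClosure f) := isCompact_iff_compactSpace.1 hf
  have hι : Continuous fun (k : weakOrbitClosure f) (x : G) => weakEval f x k :=
    continuous_pi fun x => (weakEval f x).continuous
  have hemb := hι.isClosedEmbedding fun k l h => eq_of_weakEval dense_univ fun x _ => congrFun h x
  rw [hemb.isEmbedding.continuous_iff]
  exact continuous_pi fun x => f.continuous.comp (continuous_mul_const x)

lemma secondCountableTopology_weakOrbitClosure [TopologicalSpace.SeparableSpace G]
    (hf : f ∈ WAP G G) : SecondCountableTopology (weakOrbitClosure f) := by
  have : CompactSpace (weakOrbitClosure f) := isCompact_iff_compactSpace.1 hf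
  have hι : Continuous fun (k : weakOrbitClosure f) (n : ℕ) =>
      weakEval f (TopologicalSpace.denseSeq G n) k :=
    continuous_pi fun n => (weakEval f _).continuous
  refine (hι.isClosedEmbedding fun k l h => ?_).isInducing.secondCountableTopology
  refine eq_of_weakEval (TopologicalSpace.denseRange_denseSeq G) ?_
  rintro _ ⟨n, rfl⟩
  exact congrFun h n

lemma isSeparable_range_translate [TopologicalSpace.SeparableSpace G] (hf : f ∈ WAP G G) :
    TopologicalSpace.IsSeparable (Set.range fun g : G => translate g f) := by
  let D : Set (G →ᵇ ℝ) :=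
    Set.range fun n : ℕ => translate (TopologicalSpace.denseSeq G n) f
  have hD : TopologicalSpace.IsSeparable (closure (Submodule.span ℝ D : Set (G →ᵇ ℝ))) :=
    (Set.countable_range _).isSeparable.span.closure
  refine hD.mono ?_
  rintro _ ⟨g, rfl⟩
  have h1 : toWeakSpace ℝ (G →ᵇ ℝ) (translate g f) ∈
      closure (toWeakSpace ℝ (G →ᵇ ℝ) '' (Submodule.span ℝ D : Set (G →ᵇ ℝ))) := by
    have h2 := mem_closure_image
      ((continuous_subtype_val.comp (continuous_weakOrbit hf)).continuousAt (x := g))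
      (TopologicalSpace.denseRange_denseSeq G g)
    refine closure_mono ?_ h2
    rintro _ ⟨_, ⟨n, rfl⟩, rfl⟩
    exact ⟨_, Submodule.subset_span ⟨n, rfl⟩, rfl⟩
  rw [← (Submodule.convex _).toWeakSpace_closure ℝ] at h1
  obtain ⟨h, hh, heq⟩ := h1
  have h3 : h = translate g f := (toWeakSpace ℝ (G →ᵇ ℝ)).injective heq
  rwa [h3] at hh

variable [TopologicalSpace.SeparableSpace G] [BaireSpace G]

lemma mem_RUC_of_mem_WAP (hf : f ∈ WAP G G) : f ∈ RUC G G := by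
  refine Metric.continuous_iff'.2 fun g ε hε => ?_
  obtain ⟨V, hV, ⟨v, hv⟩, hVε⟩ := exists_isOpen_dist_le (isSeparable_range_translate hf) (by
    intro h r hr
    simp only [BoundedContinuousFunction.dist_le hr, Set.ofPred_forall]
    exact isClosed_iInter fun x => isClosed_le
      ((f.continuous.comp (continuous_mul_const x)).dist continuous_const) continuous_const)
    (half_pos hε)
  have h1 : Continuous fun k : G => k * (g⁻¹ * v) := continuous_mul_const _
  filter_upwards [h1.continuousAt.preimage_mem_nhds (hV.mem_nhds (x := g * (g⁻¹ * v))
    (by simpa using hv))] with k hk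
  refine ((BoundedContinuousFunction.dist_le (half_pos hε).le).2 fun x => ?_).trans_lt
    (half_lt_self hε)
  have h2 := (dist_coe_le_dist (v⁻¹ * g * x)).trans (hVε _ hk v hv)
  change dist (f (k * (g⁻¹ * v) * (v⁻¹ * g * x))) (f (v * (v⁻¹ * g * x))) ≤ ε / 2 at h2
  have h3 : k * (g⁻¹ * v) * (v⁻¹ * g * x) = k * x := by group
  have h4 : v * (v⁻¹ * g * x) = g * x := by group
  rwa [h3, h4] at h2

lemma mem_LUC_of_mem_WAP (hf : f ∈ WAP G G) : f ∈ LUC G := by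
  have : CompactSpace (weakOrbitClosure f) := isCompact_iff_compactSpace.1 hf
  have := secondCountableTopology_weakOrbitClosure hf
  refine Metric.continuous_iff'.2 fun g ε hε => ?_
  obtain ⟨V, hV, ⟨v, hv⟩, hVε⟩ := exists_isOpen_dist_le (F := weakEval f)
    (.of_separableSpace _) (by
    intro h r hr
    simp only [ContinuousMap.dist_le hr, Set.ofPred_forall]
    exact isClosed_iInter fun k => isClosed_le
      ((continuous_weakEval f k).dist continuous_const) continuous_const)
    (half_pos hε)
  have h1 : Continuous fun k : G => v * g⁻¹ * k := continuous_const_mul _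
  filter_upwards [h1.continuousAt.preimage_mem_nhds (hV.mem_nhds (x := v * g⁻¹ * g)
    (by simpa using hv))] with k hk
  refine ((BoundedContinuousFunction.dist_le (half_pos hε).le).2 fun x => ?_).trans_lt
    (half_lt_self hε)
  have h2 := (ContinuousMap.dist_apply_le_dist (weakOrbit f (x * g * v⁻¹))).trans (hVε _ hk v hv)
  rw [weakEval_weakOrbit, weakEval_weakOrbit] at h2
  have h3 : x * g * v⁻¹ * (v * g⁻¹ * k) = x * k := by group
  rwa [h3, inv_mul_cancel_right] at h2

theorem WAP_subset_UC : WAP G G ⊆ (UC G).carrier :=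
  fun _ hf => ⟨mem_RUC_of_mem_WAP hf, mem_LUC_of_mem_WAP hf⟩

end WAP

instance : PolishSpace (Equiv.Perm ℕ) := by
  let ι : Equiv.Perm ℕ → (ℕ → ℕ) × (ℕ → ℕ) := fun g => (g, ⇑g⁻¹)
  have hι : IsInducing ι := by
    have h1 : Continuous fun (g : Equiv.Perm ℕ) (n : ℕ) => g n := continuous_induced_dom
    exact IsInducing.of_comp (h1.prodMk (h1.comp continuous_inv)) continuous_fst ⟨rfl⟩
  have hinj : Function.Injective ι := fun g h hgh => DFunLike.coe_injective (congrArg Prod.fst hgh)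
  have hrange : Set.range ι = ⋂ (n : ℕ) (m : ℕ), {a | a.1 n = m ↔ a.2 m = n} := by
    ext a
    simp only [Set.mem_range, Set.mem_iInter, Set.mem_ofPred_eq]
    constructor
    · rintro ⟨g, rfl⟩ n m
      exact ⟨fun h => by simp [ι, ← h], fun h => by simp [ι, ← h]⟩
    · intro h
      exact ⟨⟨a.1, a.2, fun n => (h n _).1 rfl, fun m => (h _ m).2 rfl⟩, rfl⟩
  refine IsClosedEmbedding.polishSpace (f := ι) ⟨⟨hι, hinj⟩, ?_⟩
  rw [hrange]
  refine isClosed_iInter fun n => isClosed_iInter fun m => ?_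
  have h1 : IsClopen {a : (ℕ → ℕ) × (ℕ → ℕ) | a.1 n = m} :=
    (isClopen_discrete {m}).preimage ((continuous_apply n).comp continuous_fst)
  have h2 : IsClopen {a : (ℕ → ℕ) × (ℕ → ℕ) | a.2 m = n} :=
    (isClopen_discrete {n}).preimage ((continuous_apply m).comp continuous_snd)
  simp only [iff_iff_implies_and_implies]
  exact (isClosed_imp h1.2 h2.1).inter (isClosed_imp h2.2 h1.1)

/-! ### Uniformly continuous functions on `S(ℕ)` are weakly almost periodic -/

section Functional

variable {X : Type*} [TopologicalSpace X] (φ : StrongDual ℝ (X →ᵇ ℝ))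

/-- A bounded functional is small on functions of norm at most `B` supported on a fibre of `u`,
with finitely many exceptions. -/
lemma finite_large_on_fibre (u : X → ℕ) (B : ℝ) {δ : ℝ} (hδ : 0 < δ) :
    {c : ℕ | ∃ h : X →ᵇ ℝ, (∀ x, |h x| ≤ B) ∧ (∀ x, u x ≠ c → h x = 0) ∧ δ < |φ h|}.Finite := by
  by_contra hinf
  obtain ⟨n, hn⟩ := exists_nat_gt (‖φ‖ * |B| / δ)
  obtain ⟨t, ht, htn⟩ := Set.Infinite.exists_subset_card_eq hinf n
  have h1 : ∀ c ∈ t, ∃ h : X →ᵇ ℝ, (∀ x, |h x| ≤ B) ∧ (∀ x, u x ≠ c → h x = 0) ∧ δ ≤ φ h := by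
    intro c hc
    obtain ⟨h, hB, h0, hφ⟩ := ht hc
    rcases lt_abs.1 hφ with h2 | h2
    · exact ⟨h, hB, h0, h2.le⟩
    · exact ⟨-h, by simpa using hB, by simpa using h0, by simpa using h2.le⟩
  choose! h hB h0 hφ using h1
  have hle : ‖∑ c ∈ t, h c‖ ≤ |B| := by
    refine (BoundedContinuousFunction.norm_le (abs_nonneg B)).2 fun x => ?_
    rw [BoundedContinuousFunction.sum_apply]
    by_cases hx : u x ∈ t
    · rw [Finset.sum_eq_single_of_mem (u x) hx fun c hc hne => h0 c hc x hne.symm]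
      exact (hB _ hx x).trans (le_abs_self B)
    · rw [Finset.sum_eq_zero fun c hc => h0 c hc x fun h => hx (h ▸ hc), norm_zero]
      exact abs_nonneg B
  have h2 : n * δ ≤ ‖φ‖ * |B| := by
    calc n * δ = ∑ c ∈ t, δ := by simp [htn]
      _ ≤ ∑ c ∈ t, φ (h c) := Finset.sum_le_sum hφ
      _ = φ (∑ c ∈ t, h c) := (map_sum φ _ _).symm
      _ ≤ ‖φ‖ * ‖∑ c ∈ t, h c‖ := (le_abs_self _).trans (φ.le_opNorm _)
      _ ≤ ‖φ‖ * |B| := by gcongr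
  rw [div_lt_iff₀ hδ] at hn
  linarith

/-- If a functional is small on functions supported on each of finitely many clopen sets, it is
small on functions which are small off their union. -/
lemma abs_apply_le_of_small_on_pieces {ι : Type*} (U : ι → Set X) (hU : ∀ i, IsClopen (U i))
    {B δ η : ℝ} (hη : 0 ≤ η) (P : Finset ι)
    (hP : ∀ i ∈ P, ∀ h : X →ᵇ ℝ, (∀ x, |h x| ≤ B) → (∀ x, x ∉ U i → h x = 0) → |φ h| ≤ δ)
    (h : X →ᵇ ℝ) (hB : ∀ x, |h x| ≤ B) (hoff : ∀ x, (∀ i ∈ P, x ∉ U i) → |h x| ≤ η) :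
    |φ h| ≤ ‖φ‖ * η + P.card * δ := by
  classical
  induction P using Finset.induction_on generalizing h with
  | empty =>
    have h1 : ‖h‖ ≤ η := (BoundedContinuousFunction.norm_le hη).2 fun x => hoff x (by simp)
    simpa using (φ.le_opNorm h).trans (mul_le_mul_of_nonneg_left h1 (norm_nonneg φ))
  | insert i P hi ih =>
    let e : X →ᵇ ℝ := BoundedContinuousFunction.indicator (U i) (hU i)
    have he : ∀ x ∈ U i, e x = 1 := fun x hx => by simp [e, hx]
    have he' : ∀ x ∉ U i, e x = 0 := fun x hx => by simp [e, hx]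
    have hB0 : ∀ x : X, 0 ≤ B := fun x => (abs_nonneg _).trans (hB x)
    have h1 : |φ (h * e)| ≤ δ := by
      refine hP i (Finset.mem_insert_self _ _) _ (fun x => ?_) fun x hx => by simp [he' x hx]
      by_cases hx : x ∈ U i
      · simpa [he x hx] using hB x
      · simpa [he' x hx] using hB0 x
    have h2 : |φ (h * (1 - e))| ≤ ‖φ‖ * η + P.card * δ := by
      refine ih (fun j hj => hP j (Finset.mem_insert_of_mem hj)) _ (fun x => ?_) fun x hx => ?_
      · by_cases hx : x ∈ U i
        · simpa [he x hx] using hB0 x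
        · simpa [he' x hx] using hB x
      · by_cases hxi : x ∈ U i
        · simpa [he x hxi] using hη
        · simpa [he' x hxi] using hoff x (by
            intro j hj
            rcases Finset.mem_insert.1 hj with rfl | hj
            exacts [hxi, hx j hj])
    have h3 : φ h = φ (h * e) + φ (h * (1 - e)) := by
      rw [← map_add]
      congr 1
      ring
    rw [h3, Finset.card_insert_of_notMem hi]
    push_cast
    linarith [abs_add_le (φ (h * e)) (φ (h * (1 - e)))]

end Functional

namespace PartialInj

lemma exists_agreeBelow_abs_extend_sub_le (f : (UC (Equiv.Perm ℕ)).toSubalgebra) {ε : ℝ}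
    (hε : 0 < ε) : ∃ N : ℕ, ∀ p q : PartialInj, AgreeBelow N p q →
      |extend f p - extend f q| ≤ ε := by
  obtain ⟨N, hN⟩ := exists_agreeBelow_abs_sub_le f.2 (show 0 < ε / 3 by positivity)
  have key : ∀ p : PartialInj, ∃ g, AgreeBelow N p (ofPerm g) ∧
      |extend f p - f.1 g| < ε / 3 := by
    intro p
    have h1 : ∀ᶠ q in 𝓝 p, |extend f p - extend f q| < ε / 3 := by
      have := ((extend f).continuous.tendsto p).eventually
        (Metric.ball_mem_nhds _ (show 0 < ε / 3 by positivity))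
      filter_upwards [this] with q hq
      rwa [← Real.dist_eq, dist_comm]
    obtain ⟨_, ⟨g, rfl⟩, hg⟩ := mem_closure_iff_frequently.1 (denseRange_ofPerm p)
      |>.and_eventually ((eventually_agreeBelow N p).and h1) |>.exists
    exact ⟨g, hg.1, by simpa only [extend_ofPerm] using hg.2⟩
  refine ⟨N, fun p q hpq => ?_⟩
  obtain ⟨g, hg, hpg⟩ := key p
  obtain ⟨g', hg', hqg'⟩ := key q
  have h1 := hN g g' ((hg.symm.trans hpq).trans hg')
  rw [abs_lt] at *
  rw [abs_le]
  constructor <;> linarith [hpg.1, hpg.2, hqg'.1, hqg'.2, h1.1, h1.2]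

/-- The function `x ↦ F (p x)` on `S(ℕ)`. -/
def orbitMap (F : C(PartialInj, ℝ)) (p : PartialInj) : Equiv.Perm ℕ →ᵇ ℝ :=
  restrict (F.comp ⟨fun q => comp p q, continuous_comp_right p⟩)

lemma orbitMap_apply (F : C(PartialInj, ℝ)) (p : PartialInj) (x : Equiv.Perm ℕ) :
    orbitMap F p x = F (comp p (ofPerm x)) := rfl

lemma orbitMap_ofPerm (f : (UC (Equiv.Perm ℕ)).toSubalgebra) (g : Equiv.Perm ℕ) :
    orbitMap (extend f) (ofPerm g) = translate g f.1 := by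
  ext x
  rw [orbitMap_apply, ← ofPerm_mul, extend_ofPerm]
  rfl

open Classical in
lemma continuous_apply_orbitMap (f : (UC (Equiv.Perm ℕ)).toSubalgebra)
    (φ : StrongDual ℝ (Equiv.Perm ℕ →ᵇ ℝ)) : Continuous fun p => φ (orbitMap (extend f) p) := by
  refine Metric.continuous_iff'.2 fun p ε hε => ?_
  obtain ⟨η, hη, hφη⟩ : ∃ η > 0, ‖φ‖ * η ≤ ε / 3 :=
    ⟨ε / 3 / (‖φ‖ + 1), by positivity, by
      rw [mul_div_assoc', div_le_iff₀ (by positivity)]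
      nlinarith [norm_nonneg φ]⟩
  obtain ⟨N, hN⟩ := exists_agreeBelow_abs_extend_sub_le f hη
  let δ := ε / 3 / (N * N + 1)
  have hδ : 0 < δ := by positivity
  let B := 2 * ‖extend f‖
  let Z : Set ℕ := ⋃ i ∈ Finset.range N, {c : ℕ | ∃ h : Equiv.Perm ℕ →ᵇ ℝ, (∀ x, |h x| ≤ B) ∧
    (∀ x, x i ≠ c → h x = 0) ∧ δ < |φ h|}
  have hZ : Z.Finite := Set.Finite.biUnion (Finset.finite_toSet _) fun i _ =>
    finite_large_on_fibre φ (fun x : Equiv.Perm ℕ => x i) B hδ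
  obtain ⟨M, hM⟩ := hZ.bddAbove
  let k : ℕ → ℕ := fun j => if h : ∃ k : ℕ, p.1 k = j then h.choose else 0
  let M' := N + M + ∑ j ∈ Finset.range N, k j + 1
  have hk : ∀ j < N, k j < M' := fun j hj => by
    have := Finset.single_le_sum (f := k) (fun _ _ => Nat.zero_le _) (Finset.mem_range.2 hj)
    omega
  filter_upwards [eventually_agreeBelow M' p] with q hq
  -- the pieces on which `q x` may take a value below `N` which `p` omits
  let U : ℕ × ℕ → Set (Equiv.Perm ℕ) := fun ij => {x | q.1 (x ij.1) = (ij.2 : OnePoint ℕ)}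
  let P := (Finset.range N ×ˢ Finset.range N).filter fun ij => ∀ k : ℕ, p.1 k ≠ ij.2
  have hU : ∀ ij, IsClopen (U ij) := by
    intro ij
    have h1 : Continuous fun x : Equiv.Perm ℕ => q.1 (x ij.1) :=
      (continuous_of_discreteTopology (f := fun n : ℕ => q.1 n)).comp (continuous_perm_apply ij.1)
    exact (isClopen_singleton_coe ij.2).preimage h1
  have hP : ∀ ij ∈ P, ∀ h : Equiv.Perm ℕ →ᵇ ℝ, (∀ x, |h x| ≤ B) →
      (∀ x, x ∉ U ij → h x = 0) → |φ h| ≤ δ := by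
    rintro ⟨i, j⟩ hij h hB h0
    simp only [P, Finset.mem_filter, Finset.mem_product, Finset.mem_range] at hij
    by_cases hc : ∃ c : ℕ, q.1 c = j
    · obtain ⟨c, hc⟩ := hc
      have hcM : M' ≤ c := by
        by_contra! hlt
        exact hij.2 c ((hq c hlt j (by omega)).2 hc)
      by_contra! hlt
      have : c ∈ Z := Set.mem_biUnion (Finset.mem_coe.2 (Finset.mem_range.2 hij.1.1))
        ⟨h, hB, fun x hx => h0 x fun hxU => hx (q.isPartialInjection.2 _ _ _ hxU hc), hlt⟩
      have := hM this
      omega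
    · have : h = 0 := BoundedContinuousFunction.ext fun x => h0 x fun hxU => hc ⟨_, hxU⟩
      simp [this, hδ.le]
  have hoff : ∀ x, (∀ ij ∈ P, x ∉ U ij) →
      |(orbitMap (extend f) q - orbitMap (extend f) p) x| ≤ η := by
    intro x hx
    refine hN (comp q (ofPerm x)) (comp p (ofPerm x)) fun i hi j hj => ?_
    rw [comp_apply_eq, comp_apply_eq]
    simp only [ofPerm_apply_eq, exists_eq_left']
    by_cases hpj : ∃ k : ℕ, p.1 k = j
    · have h1 : p.1 (k j) = (j : OnePoint ℕ) := by
        simp only [k, dif_pos hpj]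
        exact hpj.choose_spec
      have h2 : q.1 (k j) = (j : OnePoint ℕ) := (hq _ (hk j hj) _ (by omega)).1 h1
      constructor
      · intro h
        rwa [q.isPartialInjection.2 _ _ _ h h2]
      · intro h
        rwa [p.isPartialInjection.2 _ _ _ h h1]
    · refine iff_of_false (fun h => ?_) fun h => hpj ⟨_, h⟩
      refine hx (i, j) ?_ h
      simp only [P, Finset.mem_filter, Finset.mem_product, Finset.mem_range]
      exact ⟨⟨hi, hj⟩, not_exists.1 hpj⟩
  have hB : ∀ x, |(orbitMap (extend f) q - orbitMap (extend f) p) x| ≤ B := by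
    intro x
    calc |extend f _ - extend f _| ≤ |extend f _| + |extend f _| := abs_sub _ _
      _ ≤ ‖extend f‖ + ‖extend f‖ :=
        add_le_add ((extend f).norm_coe_le_norm _) ((extend f).norm_coe_le_norm _)
      _ = B := (two_mul _).symm
  have hmain := abs_apply_le_of_small_on_pieces φ U hU hη.le P hP _ hB hoff
  have hcard : (P.card : ℝ) ≤ N * N := by
    have : P.card ≤ N * N := (Finset.card_filter_le _ _).trans (by simp)
    exact_mod_cast this
  have h4 : (P.card : ℝ) * δ ≤ ε / 3 := by
    calc (P.card : ℝ) * δ ≤ (N * N + 1) * δ := by gcongr; linarith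
      _ = ε / 3 := by simp only [δ]; field_simp
  rw [Real.dist_eq, ← map_sub]
  linarith

lemma UC_subset_WAP :
    (UC (Equiv.Perm ℕ)).carrier ⊆ WAP (Equiv.Perm ℕ) (Equiv.Perm ℕ) := by
  intro f hf
  let T : PartialInj → WeakSpace ℝ (Equiv.Perm ℕ →ᵇ ℝ) := fun p =>
    toWeakSpace ℝ (Equiv.Perm ℕ →ᵇ ℝ) (orbitMap (extend ⟨f, hf⟩) p)
  have hT : Continuous T := WeakBilin.continuous_of_continuous_eval _ fun φ =>
    continuous_apply_orbitMap ⟨f, hf⟩ φ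
  refine (isCompact_range hT).closure_of_subset ?_
  rintro _ ⟨_, ⟨g, rfl⟩, rfl⟩
  exact ⟨ofPerm g, congrArg (toWeakSpace ℝ _) (orbitMap_ofPerm ⟨f, hf⟩ g)⟩

end PartialInj

lemma UC_carrier_eq_WAP :
    (UC (Equiv.Perm ℕ)).carrier = WAP (Equiv.Perm ℕ) (Equiv.Perm ℕ) :=
  PartialInj.UC_subset_WAP.antisymm WAP_subset_UC

lemma WAPAlgebra_eq_UC : WAPAlgebra (Equiv.Perm ℕ) = UC (Equiv.Perm ℕ) := by
  have h : (WAPAlgebra (Equiv.Perm ℕ)).carrier = (UC (Equiv.Perm ℕ)).carrier := by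
    rw [WAPAlgebra, ← UC_carrier_eq_WAP, GSubalgebra.generate_carrier]
  cases hA : WAPAlgebra (Equiv.Perm ℕ) with
  | mk A _ _ =>
    cases hB : UC (Equiv.Perm ℕ) with
    | mk B _ _ =>
      rw [hA, hB] at h
      obtain rfl : A = B := SetLike.coe_injective h
      rfl

end RoelckeSym

end

open RoelckeSym in
theorem mainTheorem8 :
    -- the algebras `UC(G)` and `WAP(G)` coincide
    ((UC (Equiv.Perm ℕ)).carrier = WAP (Equiv.Perm ℕ) (Equiv.Perm ℕ)) ∧
    -- the universal WAP compactification is isomorphic to `E = E(G, ℕ ∪ {∞})`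
    IsomorphicToEnvelopingSemigroup (WAPAlgebra (Equiv.Perm ℕ)) (OnePoint ℕ) ∧
    -- and so is the Roelcke compactification
    IsomorphicToEnvelopingSemigroup (UC (Equiv.Perm ℕ)) (OnePoint ℕ) ∧
    -- `E` consists of the partial injections of `ℕ`, extended by `∞`
    (envelopingSemigroup (Equiv.Perm ℕ) (OnePoint ℕ) =
      {p | ∃ (A : Set ℕ) (α : A → ℕ), Function.Injective α ∧ p = extendByInfty A α}) ∧
    -- `E` is a Cantor set
    Nonempty (envelopingSemigroup (Equiv.Perm ℕ) (OnePoint ℕ) ≃ₜ cantorSet) := by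
  refine ⟨UC_carrier_eq_WAP, ?_, PartialInj.isomorphicToEnvelopingSemigroup_UC,
    envelopingSemigroup_eq_extendByInfty, PartialInj.nonempty_homeomorph_cantorSet⟩
  rw [WAPAlgebra_eq_UC]
  exact PartialInj.isomorphicToEnvelopingSemigroup_UC
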